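/- **Setting.** Let $E$ be a set with a partial binary operation $(e,f)\mapsto ef$. For $e,f\in E$ write $e\,\omega^l f$ if $ef$ is defined and $ef=e$; $e\,\omega^r f$ if $fe$ is defined and $fe=e$; and $\omega=\omega^l\cap\omega^r$, $\mathscr L=\omega^l\cap(\omega^l)^{-1}$, $\mathscr R=\omega^r\cap(\omega^r)^{-1}$. Put $\omega^l(e)=\{g: g\,\omega^l e\}$, $\omega^r(e)=\{g: g\,\omega^r e\}$ and $M(e,f)=\omega^l(e)\cap\omega^r(f)$. For $g,h\in M(e,f)$ write $g\preceq h$ if $eg\,\omega^r eh$ and $gf\,\omega^l hf$, and let $S(e,f)=\{h\in M(e,f): g\preceq h \text{ for all } g\in M(e,f)\}$ be the sandwich set. Then $E$ is a *biordered set* if the following axioms and their left-right duals hold for all $e,f,g\in E$: - $\omega^l$ and $\omega^r$ are reflexive and transitive, and $ef$ is defined if and only if $(e,f)$ or $(f,e)$ belongs to $\omega^l\cup\omega^r$; - if $f\,\omega^r e$, then $f\,\mathscr R\,fe\,\omega\,e$; - if $g\,\omega^l f$ and $f,g\in\omega^r(e)$, then $ge\,\omega^l fe$; - if $g\,\omega^r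 f$ and $f\,\omega^r e$, then $gf=(ge)f$; - if $g\,\omega^l f$ and $f,g\in\omega^r(e)$, then $(fg)e=(fe)(ge)$; - if $f,g\in\omega^r(e)$, then $S(f,g)e=S(fe,ge)$. It is *regular* if $S(e,f)\neq\emptyset$ for all $e,f\in E$. Let $E$ be a regular biordered set with an element $0$ and a map $e\mapsto e'$ from $E$ to $E$ such that - (E1) $0\,\omega\,e$ for all $e\in E$; - (E2) for all $e,f\in E$: $e''=e$; $f\,\omega^l e$ if and only if $e'\,\omega^r f'$; and $f\,\omega^l e'$ if and only if $M(f,e)=\{0\}$; - (E3) if $f\,\omega\,e'$, then $S(e',f')\cap S(f',e')\neq\emptyset$. If $f\,\omega\,e'$, then $S(e',f')\cap S(f',e')$ has exactly one element $k$, and one writes $e\oplus f=k'$. **Proposition.** Let $e,f\in E$ with $f\,\omega\,e'$ and let $h=e\oplus f$. Then 1. $e\,\omega\,h$ and $f\,\omega\,h$; 2. for every $g\in E$ with $e\,\omega^l g$ and $f\,\omega^l g$, we have $h\,\omega^l g$; 3. for every $g\in E$ with $e\,\omega^r g$ and $f\,\omega^r g$, we have $h\,\omega^r g$. Moreover, $h$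 is the only element of $E$ with the properties 1, 2 and 3. -/

import Mathlib

/-- A set with a partial binary operation: `P.mul e f = some g` means that the product `e f` is
defined and equal to `g`; `P.mul e f = none` means that it is not defined. -/
structure PartialMagma (E : Type*) where
  mul : E → E → Option E

namespace PartialMagma

variable {E : Type*} (P : PartialMagma E)

/-- `e ω^l f`, that is, `e f = e`. -/
def oml (e f : E) : Prop := P.mul e f = some e

/-- `e ω^r f`, that is, `f e = e`. -/
def omr (e f : E) : Prop := P.mul f e = some e

/-- `ω = ω^l ∩ ω^r`. -/
def om (e f : E) : Prop := P.oml e f ∧ P.omr e f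

/-- `L = ω^l ∩ (ω^l)⁻¹`. -/
def greenL (e f : E) : Prop := P.oml e f ∧ P.oml f e

/-- `R = ω^r ∩ (ω^r)⁻¹`. -/
def greenR (e f : E) : Prop := P.omr e f ∧ P.omr f e

/-- `M(e, f) = ω^l(e) ∩ ω^r(f)`. -/
def mset (e f : E) : Set E := {g | P.oml g e ∧ P.omr g f}

/-- The relation `g ≼ h` on `M(e, f)`: `e g ω^r e h` and `g f ω^l h f`, all four products being
defined. -/
def preceq (e f g h : E) : Prop :=
  (∃ a b, P.mul e g = some a ∧ P.mul e h = some b ∧ P.omr a b) ∧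
  (∃ a b, P.mul g f = some a ∧ P.mul h f = some b ∧ P.oml a b)

/-- The sandwich set `S(e, f)`. -/
def sandwich (e f : E) : Set E :=
  {h | h ∈ P.mset e f ∧ ∀ g ∈ P.mset e f, P.preceq e f g h}

/-- Nambooripad's axioms of a biordered set; an axiom whose name ends in `_dual` is the left-right
dual of the one before it. In the axioms below, every product that occurs is defined, by the
axioms before it. -/
structure IsBiorderedSet : Prop where
  oml_refl : ∀ e, P.oml e e
  omr_refl : ∀ e, P.omr e e
  oml_trans : ∀ e f g, P.oml e f → P.oml f g → P.oml e g
  omr_trans : ∀ e f g, P.omr e f → P.omr f g → P.omr e g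
  /-- The product `e f` is defined exactly when `e` and `f` are related, in either order, by
  `ω^l` or by `ω^r`. -/
  defined_iff : ∀ e f,
    (∃ a, P.mul e f = some a) ↔ (P.omr e f ∨ P.oml e f) ∨ (P.omr f e ∨ P.oml f e)
  /-- If `f ω^r e`, then `f R f e ω e`. -/
  b21 : ∀ e f, P.omr f e → ∀ a, P.mul f e = some a → P.greenR f a ∧ P.om a e
  b21_dual : ∀ e f, P.oml f e → ∀ a, P.mul e f = some a → P.greenL f a ∧ P.om a e
  /-- If `g ω^l f` and `f, g ∈ ω^r(e)`, then `g e ω^l f e`. -/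
  b22 : ∀ e f g, P.oml g f → P.omr f e → P.omr g e →
    ∀ a b, P.mul g e = some a → P.mul f e = some b → P.oml a b
  b22_dual : ∀ e f g, P.omr g f → P.oml f e → P.oml g e →
    ∀ a b, P.mul e g = some a → P.mul e f = some b → P.omr a b
  /-- If `g ω^r f` and `f ω^r e`, then `g f = (g e) f`. -/
  b31 : ∀ e f g, P.omr g f → P.omr f e →
    ∀ a, P.mul g e = some a → P.mul g f = P.mul a f
  b31_dual : ∀ e f g, P.oml g f → P.oml f e →
    ∀ a, P.mul e g = some a → P.mul f g = P.mul f a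
  /-- If `g ω^l f` and `f, g ∈ ω^r(e)`, then `(f g) e = (f e) (g e)`. -/
  b32 : ∀ e f g, P.oml g f → P.omr f e → P.omr g e →
    ∀ a b c, P.mul f g = some a → P.mul f e = some b → P.mul g e = some c →
      P.mul a e = P.mul b c
  b32_dual : ∀ e f g, P.omr g f → P.oml f e → P.oml g e →
    ∀ a b c, P.mul g f = some a → P.mul e f = some b → P.mul e g = some c →
      P.mul e a = P.mul c b
  /-- If `f, g ∈ ω^r(e)`, then `S(f, g) e = S(f e, g e)`. -/
  b4 : ∀ e f g, P.omr f e → P.omr g e →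
    ∀ a b, P.mul f e = some a → P.mul g e = some b →
      {k | ∃ h ∈ P.sandwich f g, P.mul h e = some k} = P.sandwich a b
  b4_dual : ∀ e f g, P.oml f e → P.oml g e →
    ∀ a b, P.mul e f = some a → P.mul e g = some b →
      {k | ∃ h ∈ P.sandwich f g, P.mul e h = some k} = P.sandwich a b

/-- A regular biordered set: a biordered set all of whose sandwich sets are non-empty. -/
structure IsRegularBiorderedSet : Prop extends P.IsBiorderedSet where
  regular : ∀ e f, (P.sandwich e f).Nonempty

/-- `z` is a zero element: `z ω e` for every `e`. -/
def IsZeroElement (z : E) : Prop := ∀ e, P.om z e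

/-- The conditions on the map `e ↦ e'`, here written `c`, with respect to the zero element `z`. -/
structure IsAnnihilatorMap (z : E) (c : E → E) : Prop where
  invol : ∀ e, c (c e) = e
  oml_iff : ∀ e f, P.oml f e ↔ P.omr (c e) (c f)
  oml_compl_iff : ∀ e f, P.oml f (c e) ↔ P.mset f e = {z}

/-- If `f ω e'`, then `S(e', f') ∩ S(f', e')` is not empty. -/
def SandwichesMeet (c : E → E) : Prop :=
  ∀ e f, P.om f (c e) →
    (P.sandwich (c e) (c f) ∩ P.sandwich (c f) (c e)).Nonempty

/-- The intersection `S(e', f') ∩ S(f', e')` has exactly one element, so that `e ⊕ f` is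
well defined. -/
theorem existsUnique_sandwich {c : E → E}
    (hc : P.SandwichesMeet c) {e f : E} (hfe : P.om f (c e)) :
    ∃! k, k ∈ P.sandwich (c e) (c f) ∩ P.sandwich (c f) (c e) := by
  have key : ∀ a b, ∀ k ∈ P.sandwich a b ∩ P.sandwich b a,
      ∀ k' ∈ P.sandwich a b ∩ P.sandwich b a, P.om k k' := by
    rintro a b k ⟨⟨hk1, -⟩, ⟨hk2, -⟩⟩ k' ⟨⟨hk1', h⟩, ⟨hk2', -⟩⟩
    obtain ⟨⟨x, y, hx, hy, hxy⟩, ⟨u, v, hu, hv, huv⟩⟩ := h k hk1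
    have e1 : some x = some k := hx.symm.trans hk2.2
    have e2 : some y = some k' := hy.symm.trans hk2'.2
    have e3 : some u = some k := hu.symm.trans hk2.1
    have e4 : some v = some k' := hv.symm.trans hk2'.1
    cases e1; cases e2; cases e3; cases e4
    exact ⟨huv, hxy⟩
  obtain ⟨k, hk⟩ := hc e f hfe
  refine ⟨k, hk, fun k' hk' => ?_⟩
  have h1 := (key _ _ k' hk' k hk).1
  have h2 := (key _ _ k hk k' hk').2
  exact Option.some.inj (h1.symm.trans h2)

/-- For `f ω e'`, the element `e ⊕ f` is `k'`, where `k` is the unique element of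
`S(e', f') ∩ S(f', e')`. -/
noncomputable def oplus {c : E → E}
    (hc : P.SandwichesMeet c) {e f : E} (hfe : P.om f (c e)) : E :=
  c (P.existsUnique_sandwich hc hfe).choose

/-- The three properties of `h` relative to `e` and `f`: `e, f ω h`; if `e, f ω^l g` then
`h ω^l g`; if `e, f ω^r g` then `h ω^r g`. -/
structure IsLeastAbove (e f h : E) : Prop where
  om_left : P.om e h
  om_right : P.om f h
  oml_least : ∀ g, P.oml e g → P.oml f g → P.oml h g
  omr_least : ∀ g, P.omr e g → P.omr f g → P.omr h g

end PartialMagma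

namespace PartialMagma

variable {E : Type*} {P : PartialMagma E}

/-! The map `c` exchanges `ω^l` and `ω^r` and reverses order, so the claim is dual to one about `e'`
and `f'`: the common sandwich element `k` lies below both in `ω`, and is a greatest common lower
bound for `ω^r` and for `ω^l` separately. Membership in both sandwich sets gives the first;
maximality for `≼` gives the second, `S(e', f')` serving `ω^r` and `S(f', e')` serving `ω^l`.
Uniqueness is antisymmetry of `ω`. -/

theorem om_antisymm {e f : E} (h₁ : P.om e f) (h₂ : P.om f e) : e = f :=
  -- Both hypotheses evaluate the product `e f`: once as `e`, once as `f`.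
  Option.some.inj (h₁.1.symm.trans h₂.2)

/-- A sandwich element in `S(a, b)` that lies below `a` in `ω^r` bounds, with respect to `ω^r`,
every common lower bound of `a` and `b`. -/
theorem omr_of_mem_sandwich (hP : P.IsBiorderedSet) {a b k x : E}
    (hk : k ∈ P.sandwich a b) (hka : P.omr k a) (hxa : P.omr x a) (hxb : P.omr x b) :
    P.omr x k := by
  -- `x` need not lie in `ω^l(a)`, hence not in `M(a, b)`; its `R`-equivalent `y = x a` does.
  obtain ⟨y, hy⟩ := (hP.defined_iff x a).2 (Or.inl (Or.inl hxa))
  obtain ⟨hxy, hya⟩ := hP.b21 a x hxa y hy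
  obtain ⟨⟨u, v, hu, hv, huv⟩, -⟩ := hk.2 y ⟨hya.1, hP.omr_trans _ _ _ hxy.2 hxb⟩
  -- As `y` and `k` are in `ω^r(a)`, `a y = y` and `a k = k`, so `y ≼ k` yields `y ω^r k`.
  cases hu.symm.trans hya.2
  cases hv.symm.trans hka
  exact hP.omr_trans _ _ _ hxy.1 huv

/-- A sandwich element in `S(b, a)` that lies below `a` in `ω^l` bounds, with respect to `ω^l`,
every common lower bound of `a` and `b`. -/
theorem oml_of_mem_sandwich (hP : P.IsBiorderedSet) {a b k x : E}
    (hk : k ∈ P.sandwich b a) (hka : P.oml k a) (hxa : P.oml x a) (hxb : P.oml x b) :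
    P.oml x k := by
  -- Dually, `y = a x` is `L`-equivalent to `x` and lies in `M(b, a)`.
  obtain ⟨y, hy⟩ := (hP.defined_iff a x).2 (Or.inr (Or.inr hxa))
  obtain ⟨hxy, hya⟩ := hP.b21_dual a x hxa y hy
  obtain ⟨-, ⟨u, v, hu, hv, huv⟩⟩ := hk.2 y ⟨hP.oml_trans _ _ _ hxy.2 hxb, hya.2⟩
  cases hu.symm.trans hya.1
  cases hv.symm.trans hka
  exact hP.oml_trans _ _ _ hxy.1 huv

theorem IsLeastAbove.unique {e f h k : E} (hh : P.IsLeastAbove e f h)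
    (hk : P.IsLeastAbove e f k) : h = k :=
  om_antisymm
    ⟨hh.oml_least k hk.om_left.1 hk.om_right.1, hh.omr_least k hk.om_left.2 hk.om_right.2⟩
    ⟨hk.oml_least h hh.om_left.1 hh.om_right.1, hk.omr_least h hh.om_left.2 hh.om_right.2⟩

theorem IsAnnihilatorMap.omr_iff {z : E} {c : E → E} (hc : P.IsAnnihilatorMap z c) (e f : E) :
    P.omr f e ↔ P.oml (c e) (c f) := by
  rw [hc.oml_iff, hc.invol, hc.invol]

theorem isLeastAbove_compl {z : E} {c : E → E} (hP : P.IsBiorderedSet)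
    (hc : P.IsAnnihilatorMap z c) {e f k : E}
    (hk : k ∈ P.sandwich (c e) (c f) ∩ P.sandwich (c f) (c e)) :
    P.IsLeastAbove e f (c k) := by
  obtain ⟨h₁, h₂⟩ := hk
  have hle : P.oml k (c e) := h₁.1.1
  have hrf : P.omr k (c f) := h₁.1.2
  have hlf : P.oml k (c f) := h₂.1.1
  have hre : P.omr k (c e) := h₂.1.2
  constructor
  · exact ⟨by rwa [hc.oml_iff, hc.invol], by rwa [hc.omr_iff, hc.invol]⟩
  · exact ⟨by rwa [hc.oml_iff, hc.invol], by rwa [hc.omr_iff, hc.invol]⟩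
  · intro g hg₁ hg₂
    -- Upper `ω^l`-bounds `g` of `e`, `f` become lower `ω^r`-bounds `g'` of `e'`, `f'`.
    rw [hc.oml_iff] at hg₁ hg₂ ⊢
    rw [hc.invol]
    exact omr_of_mem_sandwich hP h₁ hre hg₁ hg₂
  · intro g hg₁ hg₂
    rw [hc.omr_iff] at hg₁ hg₂ ⊢
    rw [hc.invol]
    exact oml_of_mem_sandwich hP h₂ hle hg₁ hg₂

end PartialMagma

theorem proposition5p3 {E : Type*} (P : PartialMagma E) (hP : P.IsRegularBiorderedSet)
    (z : E) (hz : P.IsZeroElement z)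
    (c : E → E) (hc : P.IsAnnihilatorMap z c) (hS : P.SandwichesMeet c)
    (e f : E) (hfe : P.om f (c e)) :
    P.IsLeastAbove e f (P.oplus hS hfe) ∧
      ∀ k : E, P.IsLeastAbove e f k → k = P.oplus hS hfe := by
  have h : P.IsLeastAbove e f (P.oplus hS hfe) :=
    PartialMagma.isLeastAbove_compl hP.toIsBiorderedSet hc
      (P.existsUnique_sandwich hS hfe).choose_spec.1
  exact ⟨h, fun k hk => hk.unique h⟩
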